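/- Let $H$ be a densely defined, self-adjoint, nonnegative (possibly unbounded) operator with domain $\mathrm{Dom}(H)$ on a complex Hilbert space $\mathcal H$ with inner product $(\cdot,\cdot)$. Let $\sigma(H)$ be its spectrum, and let $\sigma_{\rm ess}(H)$ be its essential spectrum, i.e. the set of cluster points of $\sigma(H)$ together with the isolated eigenvalues of infinite multiplicity. Distances to the empty set are $+\infty$. Let $f,g$ be bounded, positive, continuous functions on $[0,\infty)$ such that for every $a\ge 0$ there is a constant $c>0$ with $g(t)(t-a)\ge c$ for all $t\ge a+1$, and let $f(H)$, $g(H)$ be the bounded operators given by the functional calculus of $H$. Put $c_0=\max(\sup_{[0,\infty)} f,\ \sup_{[0,\infty)} g)$ and, for $\lambda\ge 0$, $$c_1(\lambda)=\inf_{[0,\lambda]} f,\qquad c_2(\lambda)=\min\Big(\inf_{t\in[\lambda,\lambda+1]} g(t),\ \inf_{t\ge\lambda+1} g(t)(t-\lambda)\Big),\qquad c_3(\lambda)=\lambda\sup_{[0,\lambda]} g .$$ Fix $\lambda\ge 0$ and $0<\delta<c_0$. For a sequence $(\psi_j)_{j\in\mathbb N}$ in $\mathrm{Dom}(H)$ consider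 the properties 1. $\|\psi_j\|=1$ for all $j$; 2. $|(f(H)(H-\lambda)\psi_j,(H-\lambda)\psi_j)|\le\delta$ for all $j$; 3. $|(g(H)\psi_j,(H-\lambda)\psi_j)|\le\delta$ for all $j$; 4. $\psi_j\to 0$ weakly in $\mathcal H$ as $j\to\infty$. (a) If $\mathrm{dist}(\lambda,\sigma(H))<\delta/c_0$, then there is a sequence in $\mathrm{Dom}(H)$ with properties 1, 2, 3. If $\mathrm{dist}(\lambda,\sigma_{\rm ess}(H))<\delta/c_0$, then there is a sequence in $\mathrm{Dom}(H)$ with properties 1, 2, 3, 4. (b) Conversely, let $$B=\Big(\frac{c_1(\lambda)+c_2(\lambda)+c_3(\lambda)}{c_1(\lambda)\,c_2(\lambda)}\Big)^{1/3}\delta^{1/3}\ \text{ if }\lambda>0,\qquad B=\frac{\delta}{c_2(0)}\ \text{ if }\lambda=0,$$ and suppose that $\delta$ is so small that $B\le 1$ if $\lambda>0$, respectively $B<1$ if $\lambda=0$. If some sequence in $\mathrm{Dom}(H)$ has properties 1, 2, 3, then $\mathrm{dist}(\lambda,\sigma(H))\le B$; if it also has property 4, then $\mathrm{dist}(\lambda,\sigma_{\rm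 ess}(H))\le B$. -/

import Mathlib

open Set Filter Topology

noncomputable section

namespace GenWeyl

variable {E : Type*} [NormedAddCommGroup E] [InnerProductSpace ℂ E]

/-- A (possibly unbounded) operator is nonnegative: `(H x, x) ≥ 0` on its domain. -/
def IsNonneg (H : E →ₗ.[ℂ] E) : Prop :=
  ∀ x : H.domain, 0 ≤ (inner ℂ (H x) (x : E)).re

/-- The vector `(H - z) x`, for `x` in the domain of `H`. -/
def shift (H : E →ₗ.[ℂ] E) (z : ℂ) (x : H.domain) : E := H x - z • (x : E)

/-- `R` is the bounded two-sided inverse of `H - z : Dom(H) → E`. -/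
def IsResolventAt (H : E →ₗ.[ℂ] E) (z : ℂ) (R : E →L[ℂ] E) : Prop :=
  (∀ y : E, ∃ h : R y ∈ H.domain, shift H z ⟨R y, h⟩ = y) ∧
    ∀ x : H.domain, R (shift H z x) = x

/-- The spectrum of `H`: the complex numbers `z` for which `H - z` is not (boundedly) invertible. -/
def spec (H : E →ₗ.[ℂ] E) : Set ℂ :=
  {z | ¬ ∃ R : E →L[ℂ] E, IsResolventAt H z R}

/-- The eigenspace `ker (H - z)`, as a subspace of the domain of `H`. -/
def eigenspace (H : E →ₗ.[ℂ] E) (z : ℂ) : Submodule ℂ H.domain :=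
  LinearMap.ker (H.toFun - z • H.domain.subtype)

/-- The essential spectrum: the cluster points of the spectrum, together with the isolated points
of the spectrum that are eigenvalues of infinite multiplicity. -/
def essSpec (H : E →ₗ.[ℂ] E) : Set ℂ :=
  {z | z ∈ spec H ∧ AccPt z (𝓟 (spec H))} ∪
    {z | z ∈ spec H ∧ ¬ AccPt z (𝓟 (spec H)) ∧ ¬ FiniteDimensional ℂ (eigenspace H z)}

open scoped Classical in
/-- The resolvent `(H - z)⁻¹` (and `0` where `z` is in the spectrum). -/
def resolventOp (H : E →ₗ.[ℂ] E) (z : ℂ) : E →L[ℂ] E :=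
  if h : ∃ R : E →L[ℂ] E, IsResolventAt H z R then h.choose else 0

/-- `T` is the operator `f(H)`, for `H` nonnegative self-adjoint and `f` bounded and continuous on
`[0, ∞)`. With `R = (H + 1)⁻¹`, a bounded self-adjoint operator with spectrum in `[0, 1]`, and
`s = 1 / (t + 1)`, the function `f(t) / (t + 1)` equals `φ(s) = s * f(1 / s - 1)`, which is continuous
on `[0, 1]` with `φ(0) = 0`. So `f(H) (H + 1)⁻¹ = φ(R)`, where `φ(R)` is given by the continuous
functional calculus of `R`. Since the range of `R` is `Dom(H)`, which is dense,
this determines the bounded operator `f(H)`. -/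
def IsFunOf [CompleteSpace E] (H : E →ₗ.[ℂ] E) (f : ℝ → ℝ) (T : E →L[ℂ] E) : Prop :=
  T ∘L resolventOp H (-1) = cfc (fun s : ℝ => s * f (s⁻¹ - 1)) (resolventOp H (-1))

open scoped Classical in
/-- The bounded operator `f(H)`, for `H` nonnegative self-adjoint and `f` bounded and continuous on
`[0, ∞)`. -/
def funOp [CompleteSpace E] (H : E →ₗ.[ℂ] E) (f : ℝ → ℝ) : E →L[ℂ] E :=
  if h : ∃ T : E →L[ℂ] E, IsFunOf H f T then h.choose else 0

/-- The constant `c₀ = max (sup f) (sup g)`, suprema over `[0, ∞)`. -/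
def c₀ (f g : ℝ → ℝ) : ℝ := max (sSup (f '' Ici 0)) (sSup (g '' Ici 0))

/-- The constant `c₁(lam)`, the infimum of `f` over `[0, lam]`. -/
def c₁ (f : ℝ → ℝ) (lam : ℝ) : ℝ := sInf (f '' Icc 0 lam)

/-- The constant `c₂(lam)`, the minimum of the infimum of `g(t)` over `[lam, lam + 1]` and that of
`g(t) (t - lam)` over `[lam + 1, ∞)`. -/
def c₂ (g : ℝ → ℝ) (lam : ℝ) : ℝ :=
  min (sInf (g '' Icc lam (lam + 1))) (sInf ((fun t => g t * (t - lam)) '' Ici (lam + 1)))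

/-- The constant `c₃(lam)`, equal to `lam` times the supremum of `g` over `[0, lam]`. -/
def c₃ (g : ℝ → ℝ) (lam : ℝ) : ℝ := lam * sSup (g '' Icc 0 lam)

/-- Properties (1)-(3) of a sequence in the domain of `H`: unit vectors with
`|(f(H)(H - lam)ψ_j, (H - lam)ψ_j)| ≤ δ` and `|(g(H)ψ_j, (H - lam)ψ_j)| ≤ δ`. -/
def IsApproxSeq [CompleteSpace E] (H : E →ₗ.[ℂ] E) (f g : ℝ → ℝ) (lam δ : ℝ)
    (ψ : ℕ → H.domain) : Prop :=
  ∀ j, ‖(ψ j : E)‖ = 1 ∧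
    ‖inner ℂ (funOp H f (shift H lam (ψ j))) (shift H lam (ψ j))‖ ≤ δ ∧
    ‖inner ℂ (funOp H g (ψ j : E)) (shift H lam (ψ j))‖ ≤ δ

/-- Property (4): the sequence tends weakly to `0` in the whole Hilbert space. -/
def WeaklyNull (H : E →ₗ.[ℂ] E) (ψ : ℕ → H.domain) : Prop :=
  ∀ y : E, Tendsto (fun j => inner ℂ y (ψ j : E)) atTop (𝓝 0)

end GenWeyl

end

/-! Everything is expressed through the bounded self-adjoint operator `R = (H + 1)⁻¹`, whose
spectrum lies in `[0, 1]`; a spectral value `t` of `H` corresponds to `s = 1 / (t + 1)`. On the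
range of `R`, which is the domain of `H`, the operator `H - lam` becomes `1 - (1 + lam) R`, i.e. the
function `s (t - lam)`.

Existence: a continuous bump supported where `|t - lam| < δ / c₀` produces a unit vector with `‖(H -
lam)ψ‖ ≤ δ / c₀`, and Cauchy-Schwarz gives the two form bounds. Near the essential spectrum there
are either infinitely many spectral points, whose disjoint bumps give orthogonal vectors, or an
infinite-dimensional eigenspace. In both cases an orthonormal sequence results, weakly null by
Bessel.

Converse: weights `α, β ≥ 0` are chosen so that `α f(t)(t - lam)² + β g(t)(t - lam)` is at least `1`
when `|t - lam| ≥ d` and at least `1 - M` everywhere. Adding a function `χ ≥ 0` with `χ ≥ M` at the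
spectral points within `d` of `lam` gives `1 ≤ (α + β)δ + ‖χ(R)ψ_j‖` (`norm_sq_le_of_isTestWeight`).
For `d > B` the weights satisfy `(α + β)δ < 1`. If there is no spectrum within `d`, then `χ = 0` is
a contradiction. If there is no essential spectrum there, only finitely many eigenvalues of finite
multiplicity remain, `χ(R)` has finite rank, and weak convergence forces `χ(R)ψ_j → 0`, again a
contradiction. -/

namespace GenWeyl

variable {E : Type*} [NormedAddCommGroup E] [InnerProductSpace ℂ E] [CompleteSpace E]

/-! ### The resolvent at `-1` and spectral mapping -/

section Resolvent

variable {H : E →ₗ.[ℂ] E}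

theorem inner_map_symm (hH : IsSelfAdjoint H) (x y : H.domain) :
    inner ℂ (H x) (y : E) = inner ℂ (x : E) (H y) := by
  have h := LinearPMap.adjoint_isFormalAdjoint hH.dense_domain
  rw [LinearPMap.isSelfAdjoint_def.1 hH] at h
  exact h x y

omit [CompleteSpace E] in
theorem norm_le_norm_shift_neg_one (hpos : IsNonneg H) (x : H.domain) :
    ‖(x : E)‖ ≤ ‖shift H (-1) x‖ := by
  have h1 : ‖(x : E)‖ ^ 2 ≤ (inner ℂ (shift H (-1) x) (x : E)).re := by
    have h2 : inner ℂ (shift H (-1) x) (x : E) = inner ℂ (H x) (x : E) + (‖(x : E)‖ : ℂ) ^ 2 := by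
      simp [shift]
    rw [h2, Complex.add_re]
    have h3 : (((‖(x : E)‖ : ℂ)) ^ 2).re = ‖(x : E)‖ ^ 2 := by
      rw [← Complex.ofReal_pow, Complex.ofReal_re]
    linarith [hpos x]
  have h4 := (Complex.re_le_norm _).trans (norm_inner_le_norm (𝕜 := ℂ) (shift H (-1) x) (x : E))
  by_contra! h
  have : 0 < ‖(x : E)‖ := (norm_nonneg _).trans_lt h
  nlinarith

/-- `H + 1` is bounded below and the graph of `H` is complete, so the range is closed. A vector `y`
orthogonal to it lies in the domain of the adjoint `H` with `H y = -y`, hence vanishes by the lower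
bound, so the range is also dense. -/
theorem shift_neg_one_surjective (hH : IsSelfAdjoint H) (hpos : IsNonneg H) :
    Function.Surjective (shift H (-1)) := by
  have : CompleteSpace H.graph := IsClosed.completeSpace_coe (hs := hH.isClosed)
  let L : H.graph →L[ℂ] E :=
    (ContinuousLinearMap.fst ℂ E E + ContinuousLinearMap.snd ℂ E E) ∘L H.graph.subtypeL
  have hL : ∀ x : H.domain, L ⟨((x : E), H x), H.mem_graph x⟩ = shift H (-1) x := by
    intro x
    simp [L, shift, add_comm]
  have hG : ∀ p : H.graph, ∃ x : H.domain, p = ⟨((x : E), H x), H.mem_graph x⟩ := by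
    rintro ⟨⟨a, b⟩, hp⟩
    obtain ⟨x, h1, h2⟩ := (LinearPMap.mem_graph_iff H).1 hp
    refine ⟨x, Subtype.ext (Prod.ext ?_ ?_)⟩
    · exact h1.symm
    · exact h2.symm
  have hanti : AntilipschitzWith 2 L := by
    refine AddMonoidHomClass.antilipschitz_of_bound L fun p => ?_
    obtain ⟨x, rfl⟩ := hG p
    rw [hL]
    have h1 := norm_le_norm_shift_neg_one hpos x
    have h2 : ‖H x‖ ≤ ‖shift H (-1) x‖ + ‖(x : E)‖ := by
      have : H x = shift H (-1) x - (x : E) := by simp [shift]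
      rw [this]
      exact norm_sub_le _ _
    change max ‖(x : E)‖ ‖H x‖ ≤ _
    push_cast
    refine max_le ?_ ?_ <;> linarith [norm_nonneg (x : E)]
  have hclosed : IsClosed (Set.range L) := hanti.isClosed_range L.uniformContinuous
  have hdense : (LinearMap.range L.toLinearMap).topologicalClosure = ⊤ := by
    rw [Submodule.topologicalClosure_eq_top_iff, Submodule.eq_bot_iff]
    intro y hy
    rw [Submodule.mem_orthogonal'] at hy
    have hy' : ∀ x : H.domain, inner ℂ y (H x) = - inner ℂ y (x : E) := by
      intro x
      have := hy _ ⟨_, hL x⟩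
      simp only [shift, neg_smul, one_smul, sub_neg_eq_add, inner_add_right] at this
      exact eq_neg_of_add_eq_zero_left this
    have hex : ∀ x : H.domain, inner ℂ (-y) (x : E) = inner ℂ y (H x) := by
      intro x
      rw [hy' x, inner_neg_left]
    have hmem : y ∈ H.domain := by
      have := LinearPMap.mem_adjoint_domain_of_exists (T := H) y ⟨-y, hex⟩
      rwa [LinearPMap.isSelfAdjoint_def.1 hH] at this
    have hHy : H ⟨y, hmem⟩ = -y := by
      refine hH.dense_domain.eq_of_inner_left ℂ fun v hv => ?_
      rw [hex ⟨v, hv⟩]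
      exact inner_map_symm hH ⟨y, hmem⟩ ⟨v, hv⟩
    have h0 := norm_le_norm_shift_neg_one hpos ⟨y, hmem⟩
    simpa [shift, hHy] using h0
  have htop : ∀ y, y ∈ Set.range L := by
    intro y
    have h1 : y ∈ (LinearMap.range L.toLinearMap).topologicalClosure := by rw [hdense]; trivial
    have h2 : y ∈ closure (Set.range L) := h1
    rwa [hclosed.closure_eq] at h2
  intro y
  obtain ⟨p, hp⟩ := htop y
  obtain ⟨x, rfl⟩ := hG p
  exact ⟨x, (hL x).symm.trans hp⟩

theorem exists_isResolventAt_neg_one (hH : IsSelfAdjoint H) (hpos : IsNonneg H) :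
    ∃ R : E →L[ℂ] E, IsResolventAt H (-1) R := by
  let T : H.domain →ₗ[ℂ] E := H.toFun - (-1 : ℂ) • H.domain.subtype
  have hT : ∀ x, T x = shift H (-1) x := fun x => rfl
  have hinj : Function.Injective T := by
    refine (injective_iff_map_eq_zero T).2 fun x hx => ?_
    have := norm_le_norm_shift_neg_one hpos x
    rw [← hT, hx, norm_zero] at this
    exact Subtype.ext (norm_le_zero_iff.1 this)
  let e := LinearEquiv.ofBijective T ⟨hinj, shift_neg_one_surjective hH hpos⟩
  have he : ∀ y, shift H (-1) (e.symm y) = y := fun y => e.apply_symm_apply y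
  refine ⟨(H.domain.subtype ∘ₗ e.symm.toLinearMap).mkContinuous 1 fun y => ?_, fun y => ?_,
    fun x => ?_⟩
  · rw [one_mul]
    exact (norm_le_norm_shift_neg_one hpos (e.symm y)).trans_eq (by rw [he])
  · exact ⟨(e.symm y).2, he y⟩
  · change ((e.symm (e x) : H.domain) : E) = x
    rw [e.symm_apply_apply]

theorem isResolventAt_resolventOp (hH : IsSelfAdjoint H) (hpos : IsNonneg H) :
    IsResolventAt H (-1) (resolventOp H (-1)) := by
  have h := exists_isResolventAt_neg_one hH hpos
  rw [resolventOp, dif_pos h]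
  exact h.choose_spec

variable {R : E →L[ℂ] E} (hR : IsResolventAt H (-1) R)
include hR

namespace IsResolventAt

omit [CompleteSpace E] in
theorem mem_domain (y : E) : R y ∈ H.domain := (hR.1 y).1

omit [CompleteSpace E] in
theorem map_apply (y : E) : H ⟨R y, hR.mem_domain y⟩ = y - R y := by
  have := (hR.1 y).2
  simp only [shift, neg_smul, one_smul, sub_neg_eq_add] at this
  exact eq_sub_of_add_eq this

omit [CompleteSpace E] in
theorem exists_eq (x : H.domain) : ∃ y, x = ⟨R y, hR.mem_domain y⟩ :=
  ⟨shift H (-1) x, Subtype.ext (hR.2 x).symm⟩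

omit [CompleteSpace E] in
theorem shift_apply (z : ℂ) (y : E) :
    shift H z ⟨R y, hR.mem_domain y⟩ = y - (1 + z) • R y := by
  rw [shift, hR.map_apply, add_smul, one_smul, sub_sub]

theorem denseRange (hH : IsSelfAdjoint H) : DenseRange R := by
  refine hH.dense_domain.mono fun x hx => ?_
  obtain ⟨y, hy⟩ := hR.exists_eq ⟨x, hx⟩
  exact ⟨y, (congrArg Subtype.val hy).symm⟩

theorem isSelfAdjoint (hH : IsSelfAdjoint H) : IsSelfAdjoint R := by
  rw [ContinuousLinearMap.isSelfAdjoint_iff_isSymmetric]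
  intro x y
  have := inner_map_symm hH ⟨R x, hR.mem_domain x⟩ ⟨R y, hR.mem_domain y⟩
  rw [hR.map_apply, hR.map_apply, inner_sub_left, inner_sub_right] at this
  exact (sub_left_injective this).symm

omit [CompleteSpace E] in
theorem re_inner_nonneg (hpos : IsNonneg H) (x : E) : ‖R x‖ ^ 2 ≤ (inner ℂ (R x) x).re := by
  have := hpos ⟨R x, hR.mem_domain x⟩
  rw [hR.map_apply, inner_sub_left, Complex.sub_re, inner_self_eq_norm_sq_to_K] at this
  have h3 : (((‖R x‖ : ℂ)) ^ 2).re = ‖R x‖ ^ 2 := by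
    rw [← Complex.ofReal_pow, Complex.ofReal_re]
  have h4 : (inner ℂ x (R x)).re = (inner ℂ (R x) x).re := by
    rw [← inner_conj_symm, Complex.conj_re]
  rw [← h4]
  simp only [Complex.coe_algebraMap] at this
  linarith

omit [CompleteSpace E] in
theorem norm_apply_le (hpos : IsNonneg H) (x : E) : ‖R x‖ ≤ ‖x‖ := by
  have h1 := hR.re_inner_nonneg hpos x
  have h4 := (Complex.re_le_norm _).trans (norm_inner_le_norm (𝕜 := ℂ) (R x) x)
  by_contra! h
  have : 0 < ‖R x‖ := (norm_nonneg _).trans_lt h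
  nlinarith

theorem spectrum_subset (hH : IsSelfAdjoint H) (hpos : IsNonneg H) :
    spectrum ℝ R ⊆ Icc 0 1 := by
  intro s hs
  constructor
  · have h0 : 0 ≤ R := by
      rw [ContinuousLinearMap.nonneg_iff_isPositive]
      refine ⟨(hR.isSelfAdjoint hH).isSymmetric, fun x => ?_⟩
      exact (sq_nonneg _).trans (hR.re_inner_nonneg hpos x)
    exact spectrum_nonneg_of_nonneg h0 hs
  · have h1 : ‖R‖ ≤ 1 := R.opNorm_le_bound zero_le_one fun x => by
      rw [one_mul]; exact hR.norm_apply_le hpos x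
    have hs' : (s : ℂ) ∈ spectrum ℂ R := spectrum.algebraMap_mem ℂ hs
    have h2 := (spectrum.norm_le_norm_mul_of_mem hs').trans
      (mul_le_mul h1 ContinuousLinearMap.norm_id_le (norm_nonneg _) zero_le_one)
    rw [mul_one, Complex.norm_real] at h2
    exact (le_abs_self s).trans h2

omit [CompleteSpace E] in
/-- Spectral mapping between `H` and its resolvent at `-1`. -/
theorem mem_spec_iff {z : ℂ} (hz : z ≠ -1) : z ∈ spec H ↔ (z + 1)⁻¹ ∈ spectrum ℂ R := by
  have hz1 : z + 1 ≠ 0 := fun h => hz (eq_neg_of_add_eq_zero_left h)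
  rw [spec, mem_ofPred_eq, spectrum.mem_iff, not_iff_not]
  set A : E →L[ℂ] E := algebraMap ℂ (E →L[ℂ] E) (z + 1)⁻¹ - R with hA
  have hAapp : ∀ y, A y = (z + 1)⁻¹ • y - R y := fun y => by
    simp [hA, Algebra.algebraMap_eq_smul_one]
  have hshift : ∀ y, shift H z ⟨R y, hR.mem_domain y⟩ = (z + 1) • A y := by
    intro y
    rw [hR.shift_apply, hAapp, smul_sub, smul_inv_smul₀ hz1, add_comm z]
  constructor
  · rintro ⟨Q, hQ⟩
    have hQA : ∀ y, (z + 1) • Q (A y) = R y := by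
      intro y
      have := hQ.2 ⟨R y, hR.mem_domain y⟩
      rwa [hshift, map_smul] at this
    have hRes : ∀ y, R (y + (z + 1) • Q y) = Q y := by
      intro y
      obtain ⟨h, h2⟩ := hQ.1 y
      have h3 := hR.2 ⟨Q y, h⟩
      have h4 : shift H (-1) ⟨Q y, h⟩ = y + (z + 1) • Q y := by
        have h5 : H ⟨Q y, h⟩ = y + z • Q y := eq_add_of_sub_eq h2
        rw [shift, h5]
        simp only [neg_smul, one_smul, sub_neg_eq_add, add_smul]
        abel
      rwa [h4] at h3
    have hRes' : ∀ y, Q y = R y + (z + 1) • R (Q y) := by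
      intro y
      rw [← map_smul, ← map_add, hRes]
    -- Since `H - z = (z + 1) A (H + 1)`, the inverse of `A` must be `(z + 1)(H + 1)Q`, and `(H +
    -- 1)Q = 1 + (z + 1)Q`.
    let B : E →L[ℂ] E := (z + 1) • (1 + (z + 1) • Q)
    have hB : ∀ y, B y = (z + 1) • (y + (z + 1) • Q y) := fun y => by simp [B]
    refine isUnit_iff_exists.2 ⟨B, ?_, ?_⟩ <;> ext y
    · simp only [mul_apply_eq_comp, hB, one_apply_eq_self]
      rw [map_smul, hAapp, hRes, smul_sub, smul_inv_smul₀ hz1]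
      simp
    · simp only [mul_apply_eq_comp, hB, one_apply_eq_self]
      rw [hQA, hAapp, sub_add_cancel, smul_inv_smul₀ hz1]
  · intro hu
    obtain ⟨B, hAB, hBA⟩ := isUnit_iff_exists.1 hu
    have hAB' : ∀ y, A (B y) = y := fun y => by
      rw [← mul_apply_eq_comp, hAB, one_apply_eq_self]
    have hBA' : ∀ y, B (A y) = y := fun y => by
      rw [← mul_apply_eq_comp, hBA, one_apply_eq_self]
    refine ⟨(z + 1)⁻¹ • (R ∘L B), fun y => ?_, fun x => ?_⟩
    · have h1 : ((z + 1)⁻¹ • (R ∘L B)) y = R ((z + 1)⁻¹ • B y) := by simp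
      refine ⟨h1 ▸ hR.mem_domain _, ?_⟩
      refine (congrArg (shift H z) (Subtype.ext h1)).trans ((hshift ((z + 1)⁻¹ • B y)).trans ?_)
      rw [map_smul, hAB', smul_inv_smul₀ hz1]
    · obtain ⟨y, rfl⟩ := hR.exists_eq x
      rw [hshift]
      simp [hBA', smul_smul, mul_inv_cancel₀ hz1]

omit [CompleteSpace E] in
theorem neg_one_notMem_spec : (-1 : ℂ) ∉ spec H := fun h => h ⟨R, hR⟩

omit [CompleteSpace E] in
theorem inv_sub_one_mem_spec {s : ℝ} (hs : s ∈ spectrum ℝ R) (hs0 : s ≠ 0) :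
    ((s⁻¹ - 1 : ℝ) : ℂ) ∈ spec H := by
  have hz : ((s⁻¹ - 1 : ℝ) : ℂ) + 1 = (s : ℂ)⁻¹ := by push_cast; ring
  rw [hR.mem_spec_iff, hz, inv_inv]
  · exact spectrum.algebraMap_mem ℂ hs
  · intro h
    rw [h, neg_add_cancel] at hz
    exact hs0 (by exact_mod_cast inv_eq_zero.1 hz.symm)

theorem exists_eq_of_mem_spec (hH : IsSelfAdjoint H) {z : ℂ} (hz : z ∈ spec H) :
    ∃ s ∈ spectrum ℝ R, s ≠ 0 ∧ z = ((s⁻¹ - 1 : ℝ) : ℂ) := by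
  have hz0 : z ≠ -1 := fun h => hR.neg_one_notMem_spec (h ▸ hz)
  have hz1 : z + 1 ≠ 0 := fun h => hz0 (eq_neg_of_add_eq_zero_left h)
  have h1 := (hR.mem_spec_iff hz0).1 hz
  have h2 := (hR.isSelfAdjoint hH).mem_spectrum_eq_re h1
  set s : ℝ := (z + 1)⁻¹.re with hs
  clear_value s
  rw [h2] at h1
  refine ⟨s, spectrum.of_algebraMap_mem ℂ h1, ?_, ?_⟩
  · rintro rfl
    exact inv_ne_zero hz1 (by simpa using h2)
  · push_cast
    rw [← h2, inv_inv, add_sub_cancel_right]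

end IsResolventAt

end Resolvent

/-! ### Quadratic forms of functions of a self-adjoint operator -/

section QuadraticForm

variable {A : E →L[ℂ] E} {φ ψ : ℝ → ℝ}

theorem inner_cfc_left (φ : ℝ → ℝ) (A : E →L[ℂ] E) (x y : E) :
    inner ℂ (cfc φ A x) y = inner ℂ x (cfc φ A y) :=
  (cfc_predicate (p := IsSelfAdjoint) φ A).isSymmetric x y

theorem cfc_mul_apply (hφ : ContinuousOn φ (spectrum ℝ A)) (hψ : ContinuousOn ψ (spectrum ℝ A))
    (x : E) : cfc (fun s => φ s * ψ s) A x = cfc φ A (cfc ψ A x) := by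
  rw [cfc_mul φ ψ A hφ hψ, mul_apply_eq_comp]

theorem inner_cfc_cfc (hφ : ContinuousOn φ (spectrum ℝ A)) (hψ : ContinuousOn ψ (spectrum ℝ A))
    (x y : E) : inner ℂ (cfc φ A x) (cfc ψ A y) = inner ℂ (cfc (fun s => ψ s * φ s) A x) y := by
  rw [cfc_mul_apply hψ hφ, inner_cfc_left ψ]

theorem re_inner_cfc_mono (h : ∀ s ∈ spectrum ℝ A, φ s ≤ ψ s)
    (hφ : ContinuousOn φ (spectrum ℝ A)) (hψ : ContinuousOn ψ (spectrum ℝ A)) (x : E) :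
    (inner ℂ (cfc φ A x) x).re ≤ (inner ℂ (cfc ψ A x) x).re := by
  have h1 := ((ContinuousLinearMap.le_def _ _).1 (cfc_mono h hφ hψ)).re_inner_nonneg_left x
  rw [sub_apply, inner_sub_left, map_sub] at h1
  exact sub_nonneg.1 h1

theorem norm_sq_cfc_apply (hφ : ContinuousOn φ (spectrum ℝ A)) (x : E) :
    ‖cfc φ A x‖ ^ 2 = (inner ℂ (cfc (fun s => φ s * φ s) A x) x).re := by
  rw [← inner_cfc_cfc hφ hφ]
  exact (inner_self_eq_norm_sq (𝕜 := ℂ) (cfc φ A x)).symm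

theorem norm_cfc_apply_le (h : ∀ s ∈ spectrum ℝ A, |φ s| ≤ |ψ s|)
    (hφ : ContinuousOn φ (spectrum ℝ A)) (hψ : ContinuousOn ψ (spectrum ℝ A)) (x : E) :
    ‖cfc φ A x‖ ≤ ‖cfc ψ A x‖ := by
  rw [← sq_le_sq₀ (norm_nonneg _) (norm_nonneg _), norm_sq_cfc_apply hφ, norm_sq_cfc_apply hψ]
  refine re_inner_cfc_mono (fun s hs => ?_) (hφ.fun_mul hφ) (hψ.fun_mul hψ) x
  rw [← abs_mul_abs_self (φ s), ← abs_mul_abs_self (ψ s)]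
  exact mul_self_le_mul_self (abs_nonneg _) (h s hs)

theorem cfc_id_apply (hA : IsSelfAdjoint A) (x : E) : cfc (fun s : ℝ => s) A x = A x := by
  rw [cfc_id' ℝ A hA]

theorem cfc_const_mul_apply (r : ℝ) (hφ : ContinuousOn φ (spectrum ℝ A)) (x : E) :
    cfc (fun s => r * φ s) A x = (r : ℂ) • cfc φ A x := by
  rw [cfc_const_mul r φ A hφ]
  rfl

theorem cfc_add_apply (hφ : ContinuousOn φ (spectrum ℝ A)) (hψ : ContinuousOn ψ (spectrum ℝ A))
    (x : E) : cfc (fun s => φ s + ψ s) A x = cfc φ A x + cfc ψ A x := by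
  rw [cfc_add A φ ψ hφ hψ, add_apply]

theorem cfc_one_sub_mul_apply (hA : IsSelfAdjoint A) (r : ℝ) (x : E) :
    cfc (fun s : ℝ => 1 - r * s) A x = x - (r : ℂ) • A x := by
  rw [cfc_sub (fun _ : ℝ => (1 : ℝ)) (fun s => r * s) A, sub_apply,
    cfc_const_mul_apply r (φ := fun s => s) continuousOn_id, cfc_id_apply hA, cfc_const_one ℝ A hA,
    one_apply_eq_self]

end QuadraticForm

theorem continuousOn_mul_comp_inv_sub_one {f : ℝ → ℝ} {C : ℝ} (hf : ContinuousOn f (Ici 0))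
    (hC : ∀ t, 0 ≤ t → |f t| ≤ C) : ContinuousOn (fun s : ℝ => s * f (s⁻¹ - 1)) (Icc 0 1) := by
  intro s hs
  rcases hs.1.eq_or_lt with rfl | h0
  -- At `s = 0` the value is `0` whatever `f (0⁻¹ - 1)` is, and boundedness of `f` supplies the
  -- limit `0`.
  · have h1 : Tendsto (fun s : ℝ => C * |s|) (𝓝[Icc 0 1] 0) (𝓝 0) := by
      have : ContinuousWithinAt (fun s : ℝ => C * |s|) (Icc 0 1) 0 :=
        (by fun_prop : Continuous fun s : ℝ => C * |s|).continuousWithinAt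
      simpa [ContinuousWithinAt] using this
    rw [ContinuousWithinAt, zero_mul]
    refine squeeze_zero_norm' ?_ h1
    filter_upwards [self_mem_nhdsWithin] with s hs
    rw [Real.norm_eq_abs, abs_mul, mul_comm C]
    rcases hs.1.eq_or_lt with rfl | h0
    · simp
    · exact mul_le_mul_of_nonneg_left (hC _ (sub_nonneg.2 ((one_le_inv₀ h0).2 hs.2)))
        (abs_nonneg _)
  · refine continuousWithinAt_id.mul ?_
    have h1 : ContinuousWithinAt (fun s : ℝ => s⁻¹ - 1) (Icc 0 1 ∩ Ioi 0) s :=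
      ((continuousAt_inv₀ h0.ne').sub continuousAt_const).continuousWithinAt
    have h2 := (hf (s⁻¹ - 1) (sub_nonneg.2 ((one_le_inv₀ h0).2 hs.2))).comp
      (f := fun s : ℝ => s⁻¹ - 1) h1 fun u hu => sub_nonneg.2 ((one_le_inv₀ hu.2).2 hu.1.2)
    exact (continuousWithinAt_inter (Ioi_mem_nhds h0)).1 h2

/-! ### The operators `f(H)` -/

section FunOp

variable {H : E →ₗ.[ℂ] E} {f : ℝ → ℝ} {C : ℝ}

theorem IsResolventAt.continuousOn_spectrum {R : E →L[ℂ] E} (hR : IsResolventAt H (-1) R)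
    (hH : IsSelfAdjoint H) (hpos : IsNonneg H)
    (hf : ContinuousOn f (Ici 0)) (hC : ∀ t, 0 ≤ t → |f t| ≤ C) :
    ContinuousOn (fun s : ℝ => s * f (s⁻¹ - 1)) (spectrum ℝ R) :=
  (continuousOn_mul_comp_inv_sub_one hf hC).mono (hR.spectrum_subset hH hpos)

theorem norm_cfc_mul_comp_apply_le {R : E →L[ℂ] E} (hR : IsResolventAt H (-1) R)
    (hH : IsSelfAdjoint H) (hpos : IsNonneg H)
    (hf : ContinuousOn f (Ici 0)) (hC : ∀ t, 0 ≤ t → |f t| ≤ C) (x : E) :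
    ‖cfc (fun s : ℝ => s * f (s⁻¹ - 1)) R x‖ ≤ C * ‖R x‖ := by
  have hC0 : 0 ≤ C := (abs_nonneg _).trans (hC 0 le_rfl)
  have h1 : ‖cfc (fun s : ℝ => C * s) R x‖ = C * ‖R x‖ := by
    rw [cfc_const_mul_apply C (φ := fun s => s) continuousOn_id, cfc_id_apply (hR.isSelfAdjoint hH),
      norm_smul, Complex.norm_real, Real.norm_of_nonneg hC0]
  rw [← h1]
  refine norm_cfc_apply_le (fun s hs => ?_) (hR.continuousOn_spectrum hH hpos hf hC)
    (continuousOn_const.fun_mul continuousOn_id) x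
  obtain ⟨hs0, hs1⟩ := hR.spectrum_subset hH hpos hs
  rw [abs_mul, abs_mul, mul_comm |C|, abs_of_nonneg hC0]
  rcases hs0.eq_or_lt with rfl | h0
  · simp
  · exact mul_le_mul_of_nonneg_left (hC _ (sub_nonneg.2 ((one_le_inv₀ h0).2 hs1))) (abs_nonneg _)

variable (hH : IsSelfAdjoint H) (hpos : IsNonneg H)
  (hf : ContinuousOn f (Ici 0)) (hC : ∀ t, 0 ≤ t → |f t| ≤ C)
include hH hpos hf hC

/-- The bound `‖φ(R)y‖ ≤ C ‖R y‖` makes `R y ↦ φ(R)y` well defined and bounded on the dense range of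
`R`, so it extends to the whole space. -/
theorem exists_isFunOf : ∃ T : E →L[ℂ] E, IsFunOf H f T := by
  have hR := isResolventAt_resolventOp hH hpos
  set R := resolventOp H (-1) with hRdef
  refine ⟨(cfc (fun s : ℝ => s * f (s⁻¹ - 1)) R).toLinearMap.extendOfNorm R.toLinearMap, ?_⟩
  ext y
  exact LinearMap.extendOfNorm_eq (hR.denseRange hH)
    ⟨C, norm_cfc_mul_comp_apply_le hR hH hpos hf hC⟩ y

theorem funOp_resolventOp_apply (y : E) :
    funOp H f (resolventOp H (-1) y) =
      cfc (fun s : ℝ => s * f (s⁻¹ - 1)) (resolventOp H (-1)) y := by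
  have h := exists_isFunOf hH hpos hf hC
  have h1 : IsFunOf H f (funOp H f) := by
    rw [funOp, dif_pos h]
    exact h.choose_spec
  exact congrArg (fun T : E →L[ℂ] E => T y) h1

theorem norm_funOp_apply_le (x : E) : ‖funOp H f x‖ ≤ C * ‖x‖ := by
  have hR := isResolventAt_resolventOp hH hpos
  refine (hR.denseRange hH).induction_on (p := fun x => ‖funOp H f x‖ ≤ C * ‖x‖) x
    (isClosed_le (by fun_prop) (by fun_prop)) fun y => ?_
  rw [funOp_resolventOp_apply hH hpos hf hC]
  exact norm_cfc_mul_comp_apply_le hR hH hpos hf hC y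

/-- As a function of `s`, `f (s⁻¹ - 1)` may be discontinuous at `0`, so `f(H)` need not be a
continuous function of `R`. Continuous minorants suffice for lower bounds: on vectors `R y` both
sides acquire a factor `s²`, and density does the rest. -/
theorem re_inner_cfc_le_re_inner_funOp {ρ : ℝ → ℝ}
    (hρ : ContinuousOn ρ (spectrum ℝ (resolventOp H (-1))))
    (hle : ∀ s ∈ spectrum ℝ (resolventOp H (-1)), s ≠ 0 → ρ s ≤ f (s⁻¹ - 1)) (v : E) :
    (inner ℂ (cfc ρ (resolventOp H (-1)) v) v).re ≤ (inner ℂ (funOp H f v) v).re := by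
  have hR := isResolventAt_resolventOp hH hpos
  refine (hR.denseRange hH).induction_on (p := fun v =>
    (inner ℂ (cfc ρ (resolventOp H (-1)) v) v).re ≤ (inner ℂ (funOp H f v) v).re) v
    (isClosed_le (by fun_prop) (by fun_prop)) fun y => ?_
  have hφ := hR.continuousOn_spectrum hH hpos hf hC
  rw [funOp_resolventOp_apply hH hpos hf hC]
  set R := resolventOp H (-1)
  have hid : ContinuousOn (fun s : ℝ => s) (spectrum ℝ R) := continuousOn_id
  have hy := (cfc_id_apply (hR.isSelfAdjoint hH) y).symm
  rw [hy, ← cfc_mul_apply hρ hid, inner_cfc_cfc (hρ.fun_mul hid) hid, inner_cfc_cfc hφ hid]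
  refine re_inner_cfc_mono (fun s hs => ?_) (hid.fun_mul (hρ.fun_mul hid)) (hid.fun_mul hφ) y
  rcases eq_or_ne s 0 with rfl | h0
  · simp
  · have := mul_le_mul_of_nonneg_right (hle s hs h0) (mul_self_nonneg s)
    linarith

end FunOp

theorem _root_.exists_orthonormal_nat_of_not_finiteDimensional {V : Type*} [NormedAddCommGroup V]
    [InnerProductSpace ℂ V] (h : ¬ FiniteDimensional ℂ V) : ∃ e : ℕ → V, Orthonormal ℂ e := by
  let b := Module.Basis.ofVectorSpace ℂ V
  have hinf : Infinite (Module.Basis.ofVectorSpaceIndex ℂ V) := by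
    by_contra hfin
    rw [not_infinite_iff_finite] at hfin
    exact h (Module.Finite.of_basis b)
  exact ⟨_, InnerProductSpace.gramSchmidtNormed_orthonormal
    (b.linearIndependent.comp _ (Infinite.natEmbedding _).injective)⟩

omit [CompleteSpace E] in
theorem _root_.Orthonormal.tendsto_inner_zero {e : ℕ → E} (he : Orthonormal ℂ e) (y : E) :
    Tendsto (fun j => inner ℂ y (e j)) atTop (𝓝 0) := by
  have h1 := (he.inner_products_summable y).tendsto_atTop_zero
  rw [tendsto_zero_iff_norm_tendsto_zero]
  have h2 := (Real.continuous_sqrt.tendsto 0).comp h1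
  rw [Real.sqrt_zero] at h2
  refine h2.congr fun j => ?_
  rw [Function.comp_apply, Real.sqrt_sq (norm_nonneg _), norm_inner_symm]

section Constants

variable {f g : ℝ → ℝ} {lam δ : ℝ}

theorem abs_le_c₀_left (hf_pos : ∀ t, 0 ≤ t → 0 < f t) (hf_bdd : BddAbove (f '' Ici 0))
    (t : ℝ) (ht : 0 ≤ t) : |f t| ≤ c₀ f g := by
  rw [abs_of_pos (hf_pos t ht)]
  exact (le_csSup hf_bdd ⟨t, ht, rfl⟩).trans (le_max_left _ _)

theorem abs_le_c₀_right (hg_pos : ∀ t, 0 ≤ t → 0 < g t) (hg_bdd : BddAbove (g '' Ici 0))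
    (t : ℝ) (ht : 0 ≤ t) : |g t| ≤ c₀ f g := by
  rw [abs_of_pos (hg_pos t ht)]
  exact (le_csSup hg_bdd ⟨t, ht, rfl⟩).trans (le_max_right _ _)

end Constants

/-! ### Construction of approximate eigenvectors -/

section Existence

variable {H : E →ₗ.[ℂ] E} {f g : ℝ → ℝ} {lam δ r : ℝ}

theorem isApproxSeq_of_norm_shift_le (hH : IsSelfAdjoint H) (hpos : IsNonneg H)
    (hf : ContinuousOn f (Ici 0)) (hfC : ∀ t, 0 ≤ t → |f t| ≤ c₀ f g)
    (hg : ContinuousOn g (Ici 0)) (hgC : ∀ t, 0 ≤ t → |g t| ≤ c₀ f g)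
    (hδ : 0 < δ) (hδc : δ < c₀ f g) {ψ : ℕ → H.domain} (h1 : ∀ j, ‖(ψ j : E)‖ = 1)
    (h2 : ∀ j, ‖shift H lam (ψ j)‖ ≤ δ / c₀ f g) : IsApproxSeq H f g lam δ ψ := by
  intro j
  have hc : 0 < c₀ f g := hδ.trans hδc
  set v := shift H lam (ψ j)
  have hv : c₀ f g * ‖v‖ ≤ δ := by
    rw [mul_comm]
    exact (le_div_iff₀ hc).1 (h2 j)
  -- Property 2 is quadratic in `v`; `δ < c₀` makes `‖v‖ ≤ 1`, so one factor can be dropped.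
  have hv1 : ‖v‖ ≤ 1 := (h2 j).trans ((div_le_one hc).2 hδc.le)
  refine ⟨h1 j, (norm_inner_le_norm _ _).trans ?_, (norm_inner_le_norm _ _).trans ?_⟩
  · have := norm_funOp_apply_le hH hpos hf hfC v
    calc _ ≤ δ * 1 := mul_le_mul (this.trans hv) hv1 (norm_nonneg _) hδ.le
      _ = δ := mul_one δ
  · have := norm_funOp_apply_le hH hpos hg hgC (ψ j : E)
    rw [h1 j, mul_one] at this
    exact (mul_le_mul_of_nonneg_right this (norm_nonneg _)).trans hv

variable {R : E →L[ℂ] E}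

/-- On the support of `φ` the symbol of `H - lam` is at most `r`, so `H - lam` is bounded by `r` on
the range of `R φ(R)`. This range is nonzero because `s φ(s)` does not vanish at the spectral point
`s₀`. The vector is returned as a function of `R` so that disjoint supports yield orthogonality. -/
theorem IsResolventAt.exists_unit_norm_shift_le (hR : IsResolventAt H (-1) R)
    (hH : IsSelfAdjoint H) {φ : ℝ → ℝ} (hφ : ContinuousOn φ (spectrum ℝ R))
    (hsupp : ∀ s ∈ spectrum ℝ R, φ s ≠ 0 → |1 - (1 + lam) * s| ≤ r * s)
    (hr : 0 ≤ r) {s₀ : ℝ} (hs₀ : s₀ ∈ spectrum ℝ R) (hs₀' : s₀ ≠ 0) (hφs₀ : φ s₀ ≠ 0) :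
    ∃ ψ : H.domain, ‖(ψ : E)‖ = 1 ∧ ‖shift H lam ψ‖ ≤ r ∧
      ∃ x, (ψ : E) = cfc (fun s => s * φ s) R x := by
  have hA := hR.isSelfAdjoint hH
  have hid : ContinuousOn (fun s : ℝ => s) (spectrum ℝ R) := continuousOn_id
  have hne : cfc (fun s => s * φ s) R ≠ 0 := by
    intro h
    rw [← cfc_const_zero ℝ R] at h
    exact mul_ne_zero hs₀' hφs₀
      (eqOn_of_cfc_eq_cfc h (hid.fun_mul hφ) continuousOn_const hA hs₀)
  obtain ⟨x, hx⟩ : ∃ x, cfc (fun s => s * φ s) R x ≠ 0 := by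
    by_contra! h
    exact hne (ContinuousLinearMap.ext h)
  set w := cfc (fun s => s * φ s) R x with hw
  have hRw : ∀ y, R (cfc φ R y) = cfc (fun s => s * φ s) R y := fun y => by
    rw [cfc_mul_apply hid hφ, cfc_id_apply hA]
  have hle : ∀ y, ‖shift H lam ⟨R (cfc φ R y), hR.mem_domain _⟩‖ ≤
      r * ‖cfc (fun s => s * φ s) R y‖ := by
    intro y
    have h1 : r * ‖cfc (fun s => s * φ s) R y‖ = ‖cfc (fun s => r * (s * φ s)) R y‖ := by
      rw [cfc_const_mul_apply r (hid.fun_mul hφ), norm_smul, Complex.norm_real,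
        Real.norm_of_nonneg hr]
    have h2 : shift H lam ⟨R (cfc φ R y), hR.mem_domain _⟩ =
        cfc (fun s => (1 - (1 + lam) * s) * φ s) R y := by
      rw [hR.shift_apply, cfc_mul_apply (by fun_prop) hφ, cfc_one_sub_mul_apply hA]
      push_cast
      rfl
    rw [h1, h2]
    refine norm_cfc_apply_le (fun s hs => ?_) ((by fun_prop : Continuous
      fun s : ℝ => 1 - (1 + lam) * s).continuousOn.fun_mul hφ)
      (continuousOn_const.fun_mul (hid.fun_mul hφ)) y
    rcases eq_or_ne (φ s) 0 with h0 | h0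
    · simp [h0]
    · rw [← mul_assoc, abs_mul, abs_mul]
      exact mul_le_mul_of_nonneg_right ((hsupp s hs h0).trans (le_abs_self _)) (abs_nonneg _)
  have hwn : ‖w‖ ≠ 0 := norm_ne_zero_iff.2 hx
  have hy : cfc (fun s => s * φ s) R (((‖w‖⁻¹ : ℝ) : ℂ) • x) = ((‖w‖⁻¹ : ℝ) : ℂ) • w :=
    map_smul _ _ _
  have hnorm : ‖((‖w‖⁻¹ : ℝ) : ℂ) • w‖ = 1 := by
    rw [norm_smul, Complex.norm_real, norm_inv, norm_norm, inv_mul_cancel₀ hwn]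
  refine ⟨⟨R (cfc φ R (((‖w‖⁻¹ : ℝ) : ℂ) • x)), hR.mem_domain _⟩, ?_, ?_, _, hRw _⟩
  · exact (congrArg norm ((hRw _).trans hy)).trans hnorm
  · refine (hle _).trans_eq ?_
    rw [hy, hnorm, mul_one]

theorem isOpen_near (lam r : ℝ) : IsOpen {s : ℝ | 0 < s ∧ |1 - (1 + lam) * s| < r * s} :=
  isOpen_Ioi.inter (isOpen_lt (f := fun s : ℝ => |1 - (1 + lam) * s|) (g := fun s => r * s)
    (by fun_prop) (by fun_prop))

theorem abs_one_sub_mul_lt_iff {s : ℝ} (hs : 0 < s) :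
    |1 - (1 + lam) * s| < r * s ↔ |s⁻¹ - 1 - lam| < r := by
  have h : 1 - (1 + lam) * s = (s⁻¹ - 1 - lam) * s := by
    field_simp
    ring
  rw [h, abs_mul, abs_of_pos hs, mul_lt_mul_iff_of_pos_right hs]

theorem IsResolventAt.exists_near_of_mem_spec (hR : IsResolventAt H (-1) R) (hH : IsSelfAdjoint H)
    (hpos : IsNonneg H) {z : ℂ} (hz : z ∈ spec H) (hzr : dist z lam < r) :
    ∃ s ∈ spectrum ℝ R ∩ {s : ℝ | 0 < s ∧ |1 - (1 + lam) * s| < r * s},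
      ((s⁻¹ - 1 : ℝ) : ℂ) = z := by
  obtain ⟨s, hs, hs0, rfl⟩ := hR.exists_eq_of_mem_spec hH hz
  have h0 : 0 < s := (hR.spectrum_subset hH hpos hs).1.lt_of_ne' hs0
  refine ⟨s, ⟨hs, h0, ?_⟩, rfl⟩
  rw [abs_one_sub_mul_lt_iff h0]
  rwa [dist_eq_norm, ← Complex.ofReal_sub, Complex.norm_real] at hzr

theorem IsResolventAt.exists_seq_of_mem_spec (hR : IsResolventAt H (-1) R) (hH : IsSelfAdjoint H)
    (hpos : IsNonneg H) {z : ℂ} (hz : z ∈ spec H) (hzr : dist z lam < r) :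
    ∃ ψ : H.domain, ‖(ψ : E)‖ = 1 ∧ ‖shift H lam ψ‖ ≤ r := by
  obtain ⟨s₀, ⟨hs₀, hU⟩, -⟩ := hR.exists_near_of_mem_spec hH hpos hz hzr
  set U := {s : ℝ | 0 < s ∧ |1 - (1 + lam) * s| < r * s} with hUdef
  -- The distance to `Uᶜ` is a continuous bump positive exactly on `U`, provided `Uᶜ` is nonempty.
  have hne : Uᶜ.Nonempty := ⟨0, fun h => lt_irrefl _ h.1⟩
  obtain ⟨ψ, h1, h2, -⟩ := hR.exists_unit_norm_shift_le hH (φ := fun s => Metric.infDist s Uᶜ)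
    (lam := lam) (r := r) (Metric.continuous_infDist_pt _).continuousOn
    (fun s _ h0 => by
      by_contra! hlt
      exact h0 (Metric.infDist_zero_of_mem fun hs => hs.2.not_ge hlt.le))
    (dist_nonneg.trans hzr.le) hs₀ hU.1.ne'
    (((isOpen_near lam r).isClosed_compl.notMem_iff_infDist_pos hne).1 (fun h => h hU)).ne'
  exact ⟨ψ, h1, h2⟩

/-- An infinite Hausdorff space contains infinitely many disjoint nonempty open sets. Bumps on them
have pairwise product zero on the spectrum, so the resulting vectors are orthogonal. -/
theorem IsResolventAt.exists_orthonormal_of_infinite (hR : IsResolventAt H (-1) R)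
    (hH : IsSelfAdjoint H) (hr : 0 ≤ r)
    (hinf : (spectrum ℝ R ∩ {s : ℝ | 0 < s ∧ |1 - (1 + lam) * s| < r * s}).Infinite) :
    ∃ ψ : ℕ → H.domain, Orthonormal ℂ (fun j => (ψ j : E)) ∧ ∀ j, ‖shift H lam (ψ j)‖ ≤ r := by
  set U := {s : ℝ | 0 < s ∧ |1 - (1 + lam) * s| < r * s} with hUdef
  have := hinf.to_subtype
  obtain ⟨X, hXinf, hXo, hXd⟩ :=
    exists_seq_infinite_isOpen_pairwise_disjoint (spectrum ℝ R ∩ U : Set ℝ)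
  choose V hVo hV using fun n => isOpen_induced_iff.1 (hXo n)
  have hne : ∀ n, (V n ∩ U)ᶜ.Nonempty := fun n => ⟨0, fun h => lt_irrefl _ h.2.1⟩
  let φ : ℕ → ℝ → ℝ := fun n s => Metric.infDist s (V n ∩ U)ᶜ
  have hφ : ∀ n, Continuous (φ n) := fun n => Metric.continuous_infDist_pt _
  have hφ0 : ∀ n s, φ n s ≠ 0 → s ∈ V n ∩ U := fun n s h0 => by
    by_contra hs
    exact h0 (Metric.infDist_zero_of_mem hs)
  have key : ∀ n, ∃ ψ : H.domain, ‖(ψ : E)‖ = 1 ∧ ‖shift H lam ψ‖ ≤ r ∧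
      ∃ x, (ψ : E) = cfc (fun s => s * φ n s) R x := by
    intro n
    obtain ⟨⟨s₀, hs₀, hU⟩, hs₀X⟩ := (hXinf n).nonempty
    rw [← hV n] at hs₀X
    have hpos : 0 < φ n s₀ := (((hVo n).inter (isOpen_near lam r)).isClosed_compl
      |>.notMem_iff_infDist_pos (hne n)).1 fun h => h ⟨hs₀X, hU⟩
    exact hR.exists_unit_norm_shift_le hH (hφ n).continuousOn
      (fun s _ h0 => (hφ0 n s h0).2.2.le) hr hs₀ hU.1.ne' hpos.ne'
  choose ψ h1 h2 x hx using key
  refine ⟨ψ, ⟨h1, fun m n hmn => ?_⟩, h2⟩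
  have hc : ∀ n, ContinuousOn (fun s => s * φ n s) (spectrum ℝ R) := fun n =>
    (continuous_id.mul (hφ n)).continuousOn
  have h0 : cfc (fun s => s * φ n s * (s * φ m s)) R = 0 := by
    rw [← cfc_const_zero ℝ R]
    refine cfc_congr fun s hs => ?_
    by_contra hne0
    have hm := hφ0 m s fun h => hne0 (by simp [h])
    have hn := hφ0 n s fun h => hne0 (by simp [h])
    have hsm : (⟨s, hs, hm.2⟩ : (spectrum ℝ R ∩ U : Set ℝ)) ∈ X m := by
      rw [← hV m]; exact hm.1
    have hsn : (⟨s, hs, hm.2⟩ : (spectrum ℝ R ∩ U : Set ℝ)) ∈ X n := by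
      rw [← hV n]; exact hn.1
    exact disjoint_left.1 (hXd hmn) hsm hsn
  change inner ℂ (ψ m : E) (ψ n : E) = 0
  rw [hx m, hx n, inner_cfc_cfc (hc m) (hc n), h0]
  simp

omit [CompleteSpace E] in
theorem exists_orthonormal_of_eigenspace {z : ℂ} (hz : ¬ FiniteDimensional ℂ (eigenspace H z))
    (hzr : dist z lam ≤ r) :
    ∃ ψ : ℕ → H.domain, Orthonormal ℂ (fun j => (ψ j : E)) ∧ ∀ j, ‖shift H lam (ψ j)‖ ≤ r := by
  obtain ⟨e, he⟩ := exists_orthonormal_nat_of_not_finiteDimensional (V := eigenspace H z) hz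
  refine ⟨fun j => (e j : H.domain), ⟨fun j => he.1 j, fun i j hij => he.2 hij⟩, fun j => ?_⟩
  have h1 : H (e j : H.domain) = z • ((e j : H.domain) : E) := by
    have h2 := LinearMap.mem_ker.1 (e j).2
    exact sub_eq_zero.1 h2
  have h3 : ‖((e j : H.domain) : E)‖ = 1 := he.1 j
  rw [shift, h1, ← sub_smul, norm_smul, h3, mul_one, ← dist_eq_norm]
  exact hzr

theorem IsResolventAt.exists_orthonormal_of_mem_essSpec (hR : IsResolventAt H (-1) R)
    (hH : IsSelfAdjoint H) (hpos : IsNonneg H) {z : ℂ} (hz : z ∈ essSpec H)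
    (hzr : dist z lam < r) :
    ∃ ψ : ℕ → H.domain, Orthonormal ℂ (fun j => (ψ j : E)) ∧ ∀ j, ‖shift H lam (ψ j)‖ ≤ r := by
  rcases hz with ⟨-, hacc⟩ | ⟨-, -, hdim⟩
  · refine hR.exists_orthonormal_of_infinite hH (dist_nonneg.trans hzr.le) ?_
    have h1 : (Metric.ball (lam : ℂ) r ∩ spec H).Infinite := by
      have h2 : AccPt z (𝓟 (Metric.ball (lam : ℂ) r ∩ spec H)) :=
        hacc.nhds_inter (Metric.isOpen_ball.mem_nhds hzr)
      exact .of_accPt h2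
    refine Infinite.of_image (fun s : ℝ => ((s⁻¹ - 1 : ℝ) : ℂ)) (h1.mono ?_)
    rintro w ⟨hw, hws⟩
    exact hR.exists_near_of_mem_spec hH hpos hws hw
  · exact exists_orthonormal_of_eigenspace hdim hzr.le

end Existence

/-! ### Pointwise bounds from `c₁`, `c₂`, `c₃` -/

section Constants

variable {f g : ℝ → ℝ} {lam : ℝ}

theorem c₁_le (hf_pos : ∀ t, 0 ≤ t → 0 < f t) {t : ℝ} (ht : 0 ≤ t) (htl : t ≤ lam) :
    c₁ f lam ≤ f t :=
  csInf_le ⟨0, by rintro _ ⟨u, hu, rfl⟩; exact (hf_pos u hu.1).le⟩ ⟨t, ⟨ht, htl⟩, rfl⟩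

theorem sInf_image_Icc_pos (hf : ContinuousOn f (Ici 0)) (hf_pos : ∀ t, 0 ≤ t → 0 < f t)
    {a b : ℝ} (ha : 0 ≤ a) (hab : a ≤ b) : 0 < sInf (f '' Icc a b) := by
  obtain ⟨t, ht, h⟩ := isCompact_Icc.exists_sInf_image_eq (nonempty_Icc.2 hab)
    (hf.mono fun t ht => ha.trans ht.1)
  rw [h]
  exact hf_pos t (ha.trans ht.1)

theorem c₁_pos (hf : ContinuousOn f (Ici 0)) (hf_pos : ∀ t, 0 ≤ t → 0 < f t) (hlam : 0 ≤ lam) :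
    0 < c₁ f lam :=
  sInf_image_Icc_pos hf hf_pos le_rfl hlam

theorem c₂_pos (hg : ContinuousOn g (Ici 0)) (hg_pos : ∀ t, 0 ≤ t → 0 < g t) (hlam : 0 ≤ lam)
    (hg_low : ∃ c : ℝ, 0 < c ∧ ∀ t, lam + 1 ≤ t → c ≤ g t * (t - lam)) : 0 < c₂ g lam := by
  obtain ⟨c, hc, hct⟩ := hg_low
  refine lt_min (sInf_image_Icc_pos hg hg_pos hlam (by linarith)) (hc.trans_le ?_)
  refine le_csInf ⟨_, lam + 1, self_mem_Ici, rfl⟩ ?_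
  rintro _ ⟨t, ht, rfl⟩
  exact hct t ht

/-- Up to `lam + 1` one has `g ≥ c₂` and `t - lam ≥ d`; beyond it the product itself is at least
`c₂`. Hence the factor `min d 1`. -/
theorem c₂_mul_min_le (hg_pos : ∀ t, 0 ≤ t → 0 < g t) (hlam : 0 ≤ lam) (hc : 0 < c₂ g lam)
    {d t : ℝ} (hd : 0 ≤ d) (ht : lam + d ≤ t) : c₂ g lam * min d 1 ≤ g t * (t - lam) := by
  rcases le_total t (lam + 1) with h | h
  · have h1 : c₂ g lam ≤ g t := (min_le_left _ _).trans
      (csInf_le ⟨0, by rintro _ ⟨u, hu, rfl⟩; exact (hg_pos u (hlam.trans hu.1)).le⟩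
        ⟨t, ⟨by linarith, h⟩, rfl⟩)
    exact mul_le_mul h1 ((min_le_left _ _).trans (by linarith)) (le_min hd zero_le_one)
      (hg_pos t (by linarith)).le
  · have h1 : c₂ g lam ≤ g t * (t - lam) := (min_le_right _ _).trans
      (csInf_le ⟨0, by
        rintro _ ⟨u, hu, rfl⟩
        have hu' : lam + 1 ≤ u := hu
        exact mul_nonneg (hg_pos u (by linarith)).le (by linarith)⟩ ⟨t, h, rfl⟩)
    exact (mul_le_of_le_one_right hc.le (min_le_right _ _)).trans h1

theorem mul_sub_le_c₃ (hg_pos : ∀ t, 0 ≤ t → 0 < g t) (hg_bdd : BddAbove (g '' Ici 0))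
    {t : ℝ} (ht : 0 ≤ t) (htl : t ≤ lam) : g t * (lam - t) ≤ c₃ g lam := by
  have h1 : g t ≤ sSup (g '' Icc 0 lam) :=
    le_csSup (hg_bdd.mono (image_mono fun u hu => hu.1)) ⟨t, ⟨ht, htl⟩, rfl⟩
  rw [c₃, mul_comm]
  exact mul_le_mul (by linarith) h1 (hg_pos t ht).le (ht.trans htl)

theorem c₃_nonneg (hg_pos : ∀ t, 0 ≤ t → 0 < g t) (hg_bdd : BddAbove (g '' Ici 0))
    (hlam : 0 ≤ lam) : 0 ≤ c₃ g lam := by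
  simpa using mul_sub_le_c₃ hg_pos hg_bdd hlam le_rfl

end Constants

/-- Weights `α`, `β` such that `α f(t) (t - lam)² + β g(t) (t - lam)` is at least `1` at distance
`d` from `lam`, and at least `1 - M` everywhere. To the right of `lam` the function `f` may be
replaced by any smaller nonnegative number. -/
structure IsTestWeight (f g : ℝ → ℝ) (lam d α β M : ℝ) : Prop where
  α_nonneg : 0 ≤ α
  β_nonneg : 0 ≤ β
  far : ∀ t p : ℝ, 0 ≤ t → 0 ≤ p → (t ≤ lam → p = f t) → d ≤ |t - lam| →
    1 ≤ α * (p * (t - lam) ^ 2) + β * (g t * (t - lam))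
  everywhere : ∀ t p : ℝ, 0 ≤ t → 0 ≤ p →
    1 ≤ α * (p * (t - lam) ^ 2) + β * (g t * (t - lam)) + M

/-! ### Choice of the weights -/

section TestWeight

variable {f g : ℝ → ℝ} {lam d δ B : ℝ}

theorem one_le_add_of_nonneg (hg_pos : ∀ t, 0 ≤ t → 0 < g t) (hg_bdd : BddAbove (g '' Ici 0))
    {α β : ℝ} (hα : 0 ≤ α) (hβ : 0 ≤ β) (hlam : 0 ≤ lam) (t p : ℝ) (ht : 0 ≤ t) (hp : 0 ≤ p) :
    1 ≤ α * (p * (t - lam) ^ 2) + β * (g t * (t - lam)) + (1 + β * c₃ g lam) := by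
  have h1 : 0 ≤ α * (p * (t - lam) ^ 2) := by positivity
  have h2 : -c₃ g lam ≤ g t * (t - lam) := by
    rcases le_total t lam with h | h
    · linarith [mul_sub_le_c₃ hg_pos hg_bdd ht h]
    · have := mul_nonneg (hg_pos t ht).le (sub_nonneg.2 h)
      linarith [c₃_nonneg hg_pos hg_bdd hlam]
  have h3 := mul_le_mul_of_nonneg_left h2 hβ
  linarith

/-- `β` makes the `g` term at least `1` to the right of `lam + d`. On the left that term can fall to
`-β c₃`, so `α` is chosen to make the `f` term at least `1 + β c₃` to the left of `lam - d`. -/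
theorem isTestWeight_of_pos (hf : ContinuousOn f (Ici 0)) (hf_pos : ∀ t, 0 ≤ t → 0 < f t)
    (hg_pos : ∀ t, 0 ≤ t → 0 < g t) (hg_bdd : BddAbove (g '' Ici 0))
    (hlam : 0 ≤ lam) (hc₂ : 0 < c₂ g lam) (hd : 0 < d) :
    IsTestWeight f g lam d ((1 + 1 / (c₂ g lam * min d 1) * c₃ g lam) / (c₁ f lam * d ^ 2))
      (1 / (c₂ g lam * min d 1)) (1 + 1 / (c₂ g lam * min d 1) * c₃ g lam) := by
  have hc₁ := c₁_pos hf hf_pos hlam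
  have hc₃ := c₃_nonneg hg_pos hg_bdd hlam
  have hε : 0 < min d 1 := lt_min hd one_pos
  have hβ : 0 ≤ 1 / (c₂ g lam * min d 1) := by positivity
  have hα : 0 ≤ (1 + 1 / (c₂ g lam * min d 1) * c₃ g lam) / (c₁ f lam * d ^ 2) := by positivity
  refine ⟨hα, hβ, fun t p ht hp hpf hdt => ?_,
    one_le_add_of_nonneg hg_pos hg_bdd hα hβ hlam⟩
  rcases le_total t lam with h | h
  · have h1 : c₁ f lam * d ^ 2 ≤ p * (t - lam) ^ 2 := by
      rw [hpf h, ← sq_abs (t - lam)]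
      have := c₁_le hf_pos ht h
      have := (hf_pos t ht).le
      gcongr
    have h2 := mul_le_mul_of_nonneg_left h1 hα
    rw [div_mul_cancel₀ _ (by positivity)] at h2
    have h3 := mul_le_mul_of_nonneg_left (mul_sub_le_c₃ hg_pos hg_bdd ht h) hβ
    linarith
  · have h1 : lam + d ≤ t := by
      rw [abs_of_nonneg (sub_nonneg.2 h)] at hdt
      linarith
    have h2 := mul_le_mul_of_nonneg_left (c₂_mul_min_le hg_pos hlam hc₂ hd.le h1) hβ
    rw [one_div_mul_cancel (by positivity)] at h2
    have h3 := mul_nonneg hα (mul_nonneg hp (sq_nonneg (t - lam)))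
    linarith

/-- Nothing of `[0, ∞)` lies to the left of `lam = 0`, so the `f` term is not needed. -/
theorem isTestWeight_of_eq_zero (hg_pos : ∀ t, 0 ≤ t → 0 < g t) (hg_bdd : BddAbove (g '' Ici 0))
    (hlam : lam = 0) (hc₂ : 0 < c₂ g lam) (hd : 0 < d) :
    IsTestWeight f g lam d 0 (1 / (c₂ g lam * min d 1))
      (1 + 1 / (c₂ g lam * min d 1) * c₃ g lam) := by
  have hε : 0 < min d 1 := lt_min hd one_pos
  have hβ : 0 ≤ 1 / (c₂ g lam * min d 1) := by positivity
  refine ⟨le_rfl, hβ, fun t p ht hp hpf hdt => ?_,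
    one_le_add_of_nonneg hg_pos hg_bdd le_rfl hβ hlam.ge⟩
  have h1 : lam + d ≤ t := by
    rw [abs_of_nonneg (by linarith)] at hdt
    linarith
  have h2 := mul_le_mul_of_nonneg_left (c₂_mul_min_le hg_pos hlam.ge hc₂ hd.le h1) hβ
  rw [one_div_mul_cancel (by positivity)] at h2
  linarith

/-- At `d = B` the sum of the weights is `(a B² + b B + c) / (a b B³)`, at most `(a + b + c) / (a b
B³) = 1 / δ` because `B ≤ 1`. Strictness comes from `B² < d²`, so `B = 1` is allowed. -/
theorem weights_mul_lt_one_of_pos {a b c : ℝ} (ha : 0 < a) (hb : 0 < b) (hc : 0 ≤ c) (hδ : 0 < δ)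
    (hB : B = ((a + b + c) / (a * b)) ^ (1 / 3 : ℝ) * δ ^ (1 / 3 : ℝ)) (hB1 : B ≤ 1)
    (hBd : B < d) :
    ((1 + 1 / (b * min d 1) * c) / (a * d ^ 2) + 1 / (b * min d 1)) * δ < 1 := by
  have hB0 : 0 < B := by rw [hB]; positivity
  have hB3 : B ^ 3 = (a + b + c) / (a * b) * δ := by
    rw [hB, ← Real.mul_rpow (by positivity) hδ.le, ← Real.rpow_natCast, ← Real.rpow_mul
      (by positivity)]
    norm_num
  have hd : 0 < d := hB0.trans hBd
  have hε : B ≤ min d 1 := le_min hBd.le hB1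
  have h1 : 1 / (b * min d 1) ≤ 1 / (b * B) := by gcongr
  have h2 : (1 + 1 / (b * min d 1) * c) / (a * d ^ 2) < (1 + 1 / (b * B) * c) / (a * B ^ 2) := by
    calc _ ≤ (1 + 1 / (b * B) * c) / (a * d ^ 2) := by gcongr
      _ < _ := by gcongr
  have h3 : (1 + 1 / (b * B) * c) / (a * B ^ 2) + 1 / (b * B) ≤ (a + b + c) / (a * b * B ^ 3) := by
    have : (1 + 1 / (b * B) * c) / (a * B ^ 2) + 1 / (b * B) =
        (a * B ^ 2 + b * B + c) / (a * b * B ^ 3) := by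
      field_simp
      ring
    rw [this]
    have h4 : B ^ 2 ≤ 1 := pow_le_one₀ hB0.le hB1
    gcongr
    · exact mul_le_of_le_one_right ha.le h4
    · exact mul_le_of_le_one_right hb.le hB1
  have h4 : (a + b + c) / (a * b * B ^ 3) * δ = 1 := by
    rw [hB3]
    have : a + b + c ≠ 0 := by positivity
    field_simp
  exact (mul_lt_mul_of_pos_right (by linarith) hδ).trans_eq h4

end TestWeight

/-! ### From approximating sequences to the spectrum -/

section Converse

variable {H : E →ₗ.[ℂ] E} {f g : ℝ → ℝ} {C lam d δ B α β M : ℝ}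

theorem norm_sq_le_of_isTestWeight (hH : IsSelfAdjoint H) (hpos : IsNonneg H)
    (hf : ContinuousOn f (Ici 0)) (hf_pos : ∀ t, 0 ≤ t → 0 < f t)
    (hfC : ∀ t, 0 ≤ t → |f t| ≤ C)
    (hg : ContinuousOn g (Ici 0)) (hgC : ∀ t, 0 ≤ t → |g t| ≤ C) (hlam : 0 ≤ lam)
    (hw : IsTestWeight f g lam d α β M) {χ : ℝ → ℝ}
    (hχ : ContinuousOn χ (spectrum ℝ (resolventOp H (-1)))) (hχ0 : ∀ s, 0 ≤ χ s)
    (hχM : ∀ s ∈ spectrum ℝ (resolventOp H (-1)), |1 - (1 + lam) * s| ≤ d * s → M ≤ χ s)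
    (ψ : H.domain) :
    ‖(ψ : E)‖ ^ 2 ≤ α * ‖inner ℂ (funOp H f (shift H lam ψ)) (shift H lam ψ)‖ +
      β * ‖inner ℂ (funOp H g (ψ : E)) (shift H lam ψ)‖ +
      (inner ℂ (cfc χ (resolventOp H (-1)) (ψ : E)) (ψ : E)).re := by
  have hR := isResolventAt_resolventOp hH hpos
  have hgφ := hR.continuousOn_spectrum hH hpos hg hgC
  have hfφ := hR.continuousOn_spectrum hH hpos hf hfC
  have hA := hR.isSelfAdjoint hH
  have hS := hR.spectrum_subset hH hpos
  obtain ⟨u, rfl⟩ := hR.exists_eq ψ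
  have hgR := funOp_resolventOp_apply hH hpos hg hgC u
  -- `k` is `1 / s` truncated at `t = lam`. Thus `ρ = s f k` is continuous up to `s = 0`, lies below
  -- `f`, and equals `f` for `t ≤ lam`, the only side where the size of `f` matters.
  set k : ℝ → ℝ := fun s => (max s (1 + lam)⁻¹)⁻¹ with hk
  have hlam1 : 0 < (1 + lam)⁻¹ := by positivity
  have hmax : ∀ s, 0 < max s (1 + lam)⁻¹ := fun s => hlam1.trans_le (le_max_right _ _)
  have hk_cont : Continuous k :=
    (continuous_id.max continuous_const).inv₀ fun s => (hmax s).ne'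
  have hk0 : ∀ s, 0 < k s := fun s => inv_pos.2 (hmax s)
  set ρ : ℝ → ℝ := fun s => s * f (s⁻¹ - 1) * k s with hρdef
  have ht0 : ∀ s ∈ spectrum ℝ (resolventOp H (-1)), 0 < s → 0 ≤ s⁻¹ - 1 := fun s hs h0 =>
    sub_nonneg.2 ((one_le_inv₀ h0).2 (hS hs).2)
  have hρ : ContinuousOn ρ (spectrum ℝ (resolventOp H (-1))) := hfφ.fun_mul hk_cont.continuousOn
  have hρf : ∀ s ∈ spectrum ℝ (resolventOp H (-1)), s ≠ 0 → ρ s ≤ f (s⁻¹ - 1) := by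
    intro s hs h0
    have h0 : 0 < s := (hS hs).1.lt_of_ne' h0
    have h1 : s * k s ≤ 1 := by
      rw [hk, ← div_eq_mul_inv, div_le_one (hmax s)]
      exact le_max_left _ _
    have := mul_le_of_le_one_right (hf_pos _ (ht0 s hs h0)).le h1
    calc ρ s = f (s⁻¹ - 1) * (s * k s) := by rw [hρdef]; ring
      _ ≤ _ := this
  have hfv := re_inner_cfc_le_re_inner_funOp hH hpos hf hfC hρ hρf
    (shift H lam ⟨resolventOp H (-1) u, hR.mem_domain u⟩)
  set R := resolventOp H (-1) with hRdef
  set l : ℝ → ℝ := fun s => 1 - (1 + lam) * s with hl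
  have hlc : ContinuousOn l (spectrum ℝ R) := by fun_prop
  have hid : ContinuousOn (fun s : ℝ => s) (spectrum ℝ R) := continuousOn_id
  have hv : shift H lam ⟨R u, hR.mem_domain u⟩ = cfc l R u := by
    rw [hR.shift_apply, cfc_one_sub_mul_apply hA]
    push_cast
    rfl
  have hcid : R u = cfc (fun s : ℝ => s) R u := (cfc_id_apply hA u).symm
  rw [hv] at hfv ⊢
  change ‖R u‖ ^ 2 ≤ α * _ + β * ‖inner ℂ (funOp H g (R u)) _‖ + (inner ℂ (cfc χ R (R u)) (R u)).re
  have e1 : ‖R u‖ ^ 2 = (inner ℂ (cfc (fun s : ℝ => s * s) R u) u).re := by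
    rw [← norm_sq_cfc_apply hid, ← hcid]
  have e2 : inner ℂ (cfc ρ R (cfc l R u)) (cfc l R u) =
      inner ℂ (cfc (fun s => l s * (ρ s * l s)) R u) u := by
    rw [← cfc_mul_apply hρ hlc, inner_cfc_cfc (hρ.fun_mul hlc) hlc]
  have e3 : inner ℂ (funOp H g (R u)) (cfc l R u) =
      inner ℂ (cfc (fun s => l s * (s * g (s⁻¹ - 1))) R u) u := by
    rw [hgR, inner_cfc_cfc hgφ hlc]
  have e4 : inner ℂ (cfc χ R (R u)) (R u) = inner ℂ (cfc (fun s => s * (χ s * s)) R u) u := by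
    rw [hcid, ← cfc_mul_apply hχ hid, inner_cfc_cfc (hχ.fun_mul hid) hid]
  have c2 := hlc.fun_mul (hρ.fun_mul hlc)
  have c3 := hlc.fun_mul hgφ
  have c4 := hid.fun_mul (hχ.fun_mul hid)
  -- With `ψ = R u` every term is a form in `u` whose symbol carries the factor `s²`; removing it
  -- leaves the inequality for the weights at `t = 1 / s - 1`.
  have hmain : (inner ℂ (cfc (fun s : ℝ => s * s) R u) u).re ≤
      (inner ℂ (cfc (fun s => α * (l s * (ρ s * l s)) + β * (l s * (s * g (s⁻¹ - 1))) +
        s * (χ s * s)) R u) u).re := by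
    refine re_inner_cfc_mono (fun s hs => ?_) (hid.fun_mul hid)
      (((continuousOn_const.fun_mul c2).fun_add (continuousOn_const.fun_mul c3)).fun_add c4) u
    rcases (hS hs).1.eq_or_lt with rfl | h0
    · simp [hρdef]
    set t := s⁻¹ - 1 with ht
    set p := f t * (s * k s) with hp
    have hp0 : 0 ≤ p := by
      have := hf_pos t (ht0 s hs h0)
      have := hk0 s
      positivity
    have hpf : t ≤ lam → p = f t := by
      intro htl
      have h1 : (1 + lam)⁻¹ ≤ s := by
        rw [inv_le_comm₀ (by positivity) h0]
        linarith
      rw [hp, hk]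
      simp only
      rw [max_eq_left h1, mul_inv_cancel₀ h0.ne', mul_one]
    have hlt : l s = s * (t - lam) := by
      rw [hl, ht]
      field_simp
      ring
    have hscale : α * (l s * (ρ s * l s)) + β * (l s * (s * g t)) + s * (χ s * s) =
        s * s * (α * (p * (t - lam) ^ 2) + β * (g t * (t - lam)) + χ s) := by
      rw [hlt, hp, hρdef]
      ring
    rw [hscale]
    refine le_mul_of_one_le_right (mul_self_nonneg s) ?_
    by_cases hd : d ≤ |t - lam|
    · linarith [hw.far t p (ht0 s hs h0) hp0 hpf hd, hχ0 s]
    · have h1 : M ≤ χ s := hχM s hs <| by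
        change |l s| ≤ d * s
        rw [hlt, abs_mul, abs_of_pos h0, mul_comm]
        exact mul_le_mul_of_nonneg_right (not_le.1 hd).le h0.le
      linarith [hw.everywhere t p (ht0 s hs h0) hp0]
  rw [cfc_add_apply ((continuousOn_const.fun_mul c2).fun_add (continuousOn_const.fun_mul c3)) c4,
    cfc_add_apply (continuousOn_const.fun_mul c2) (continuousOn_const.fun_mul c3),
    cfc_const_mul_apply _ c2, cfc_const_mul_apply _ c3, inner_add_left, inner_add_left,
    inner_smul_left, inner_smul_left, Complex.conj_ofReal, Complex.conj_ofReal, Complex.add_re,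
    Complex.add_re, Complex.re_ofReal_mul, Complex.re_ofReal_mul, ← e2, ← e3, ← e4, ← e1] at hmain
  refine hmain.trans ?_
  gcongr
  · exact hw.α_nonneg
  · exact hfv.trans (Complex.re_le_norm _)
  · exact hw.β_nonneg
  · exact Complex.re_le_norm _

/-- In an orthonormal basis of `V` the finitely many coordinates of `T ψ_j` are inner products of
`ψ_j` with fixed vectors. -/
theorem tendsto_zero_of_finiteDimensional_range {T : E →L[ℂ] E} {V : Submodule ℂ E}
    [FiniteDimensional ℂ V] (hT : ∀ x, T x ∈ V) {ψ : ℕ → E}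
    (hψ : ∀ y, Tendsto (fun j => inner ℂ y (ψ j)) atTop (𝓝 0)) :
    Tendsto (fun j => T (ψ j)) atTop (𝓝 0) := by
  let b := stdOrthonormalBasis ℂ V
  have h : ∀ x, T x = ∑ i, inner ℂ (ContinuousLinearMap.adjoint T (b i : E)) x • (b i : E) := by
    intro x
    have h1 := congrArg Subtype.val (b.sum_repr' ⟨T x, hT x⟩)
    rw [Submodule.coe_sum] at h1
    refine h1.symm.trans (Finset.sum_congr rfl fun i _ => ?_)
    rw [ContinuousLinearMap.adjoint_inner_left]
    rfl
  simp_rw [h]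
  rw [show (0 : E) = ∑ i, (0 : ℂ) • (b i : E) by simp]
  exact tendsto_finsetSum _ fun i _ => (hψ _).smul_const _

omit [CompleteSpace E] in
theorem IsResolventAt.not_accPt_spectrum {R : E →L[ℂ] E} (hR : IsResolventAt H (-1) R) {s : ℝ}
    (hs : s ≠ 0) (h : ¬ AccPt ((s⁻¹ - 1 : ℝ) : ℂ) (𝓟 (spec H))) : ¬ AccPt s (𝓟 (spectrum ℝ R)) := by
  intro hacc
  refine h ?_
  rw [accPt_iff_frequently] at hacc ⊢
  have hc : ContinuousAt (fun s : ℝ => ((s⁻¹ - 1 : ℝ) : ℂ)) s :=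
    Complex.continuous_ofReal.continuousAt.comp
      (f := fun s : ℝ => s⁻¹ - 1) ((continuousAt_inv₀ hs).sub continuousAt_const)
  refine hc.tendsto.frequently ((hacc.and_eventually (isOpen_ne.mem_nhds hs)).mono ?_)
  rintro y ⟨⟨hys, hy⟩, hy0⟩
  refine ⟨fun he => hys ?_, hR.inv_sub_one_mem_spec hy hy0⟩
  exact inv_injective (sub_left_injective (Complex.ofReal_injective he))

theorem continuousOn_ite_eq {S : Set ℝ} {i M : ℝ} (hi : ¬ AccPt i (𝓟 S)) :
    ContinuousOn (fun s : ℝ => if s = i then M else 0) S := by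
  intro s _
  rcases eq_or_ne s i with rfl | h
  · exact continuousWithinAt_of_not_accPt hi
  · refine (continuousAt_const (y := (0 : ℝ))).congr ?_ |>.continuousWithinAt
    filter_upwards [isOpen_ne.mem_nhds h] with u hu
    rw [if_neg hu]

/-- The function supported at `i` satisfies `s e(s) = i e(s)`, so its values are eigenvectors of
`R`, hence of `H`. -/
theorem IsResolventAt.cfc_ite_eq_apply_mem {R : E →L[ℂ] E} (hR : IsResolventAt H (-1) R)
    (hH : IsSelfAdjoint H) {i : ℝ} (hi0 : i ≠ 0) (hi : ¬ AccPt i (𝓟 (spectrum ℝ R))) (x : E) :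
    cfc (fun s : ℝ => if s = i then M else 0) R x ∈
      (eigenspace H ((i⁻¹ - 1 : ℝ) : ℂ)).map H.domain.subtype := by
  have hc := continuousOn_ite_eq (M := M) hi
  set y := cfc (fun s : ℝ => if s = i then M else 0) R x with hy
  have h1 : R y = (i : ℂ) • y := by
    rw [hy, ← cfc_id_apply (hR.isSelfAdjoint hH), ← cfc_mul_apply (φ := fun s => s) continuousOn_id hc,
      ← cfc_const_mul_apply i hc]
    congr 2
    ext s
    split_ifs with h <;> simp [h]
  have hiC : (i : ℂ) ≠ 0 := Complex.ofReal_ne_zero.2 hi0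
  have h2 : R ((i : ℂ)⁻¹ • y) = y := by
    rw [map_smul, h1, inv_smul_smul₀ hiC]
  refine ⟨⟨R ((i : ℂ)⁻¹ • y), hR.mem_domain _⟩, ?_, h2⟩
  refine LinearMap.mem_ker.2 ?_
  have h3 := hR.shift_apply ((i⁻¹ - 1 : ℝ) : ℂ) ((i : ℂ)⁻¹ • y)
  refine h3.trans ?_
  rw [h2, ← sub_smul]
  push_cast
  simp

/-- The common part of the converse statements: a lower bound for the distance to the spectrum
contradicts the existence of the approximating sequence. -/
theorem infEDist_le_of_isTestWeight (hH : IsSelfAdjoint H) (hpos : IsNonneg H)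
    (hf : ContinuousOn f (Ici 0)) (hf_pos : ∀ t, 0 ≤ t → 0 < f t)
    (hfC : ∀ t, 0 ≤ t → |f t| ≤ C)
    (hg : ContinuousOn g (Ici 0)) (hgC : ∀ t, 0 ≤ t → |g t| ≤ C) (hlam : 0 ≤ lam)
    (hw : ∀ d, B < d → ∃ α β M, IsTestWeight f g lam d α β M ∧ 0 ≤ M ∧ (α + β) * δ < 1)
    {ψ : ℕ → H.domain} (hψ : IsApproxSeq H f g lam δ ψ) :
    Metric.infEDist (lam : ℂ) (spec H) ≤ ENNReal.ofReal B ∧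
      (WeaklyNull H ψ → Metric.infEDist (lam : ℂ) (essSpec H) ≤ ENNReal.ofReal B) := by
  have hR := isResolventAt_resolventOp hH hpos
  have hS := hR.spectrum_subset hH hpos
  have hBd : ∀ {d : ℝ}, ENNReal.ofReal B < ENNReal.ofReal d → B < d := fun h => by
    by_contra! hle
    exact h.not_ge (ENNReal.ofReal_le_ofReal hle)
  have hbound : ∀ {d α β M : ℝ}, IsTestWeight f g lam d α β M → ∀ {χ : ℝ → ℝ},
      ContinuousOn χ (spectrum ℝ (resolventOp H (-1))) → (∀ s, 0 ≤ χ s) →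
      (∀ s ∈ spectrum ℝ (resolventOp H (-1)), |1 - (1 + lam) * s| ≤ d * s → M ≤ χ s) →
      ∀ j, 1 ≤ (α + β) * δ + ‖cfc χ (resolventOp H (-1)) (ψ j : E)‖ := by
    intro d α β M hw χ hχ hχ0 hχM j
    obtain ⟨h1, h2, h3⟩ := hψ j
    have h4 := norm_sq_le_of_isTestWeight hH hpos hf hf_pos hfC hg hgC hlam hw hχ hχ0 hχM (ψ j)
    have h5 := (Complex.re_le_norm _).trans
      (norm_inner_le_norm (𝕜 := ℂ) (cfc χ (resolventOp H (-1)) (ψ j : E)) (ψ j : E))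
    rw [h1, mul_one] at h5
    rw [h1, one_pow] at h4
    have h6 := mul_le_mul_of_nonneg_left h2 hw.α_nonneg
    have h7 := mul_le_mul_of_nonneg_left h3 hw.β_nonneg
    linarith
  have hnear : ∀ {s d : ℝ}, s ∈ spectrum ℝ (resolventOp H (-1)) →
      |1 - (1 + lam) * s| ≤ d * s → s ≠ 0 ∧ edist (lam : ℂ) ((s⁻¹ - 1 : ℝ) : ℂ) ≤
        ENNReal.ofReal d := by
    intro s d hs hsd
    have h0 : s ≠ 0 := by
      rintro rfl
      norm_num at hsd
    have hs0 : 0 < s := (hS hs).1.lt_of_ne' h0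
    refine ⟨h0, ?_⟩
    rw [edist_comm, edist_dist, dist_eq_norm, ← Complex.ofReal_sub, Complex.norm_real,
      Real.norm_eq_abs]
    refine ENNReal.ofReal_le_ofReal ?_
    have h : 1 - (1 + lam) * s = (s⁻¹ - 1 - lam) * s := by
      field_simp
      ring
    rw [h, abs_mul, abs_of_pos hs0] at hsd
    exact le_of_mul_le_mul_right hsd hs0
  constructor
  · by_contra! hlt
    obtain ⟨d, -, h1, h2⟩ := ENNReal.lt_iff_exists_real_btwn.1 hlt
    obtain ⟨α, β, M, hw, -, hlt1⟩ := hw d (hBd h1)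
    have h3 := hbound hw (χ := fun _ => 0) continuousOn_const (fun _ => le_rfl) (fun s hs hsd => by
      obtain ⟨h0, h4⟩ := hnear hs hsd
      exact absurd (h2.trans_le ((Metric.infEDist_le_edist_of_mem
        (hR.inv_sub_one_mem_spec hs h0)).trans h4)) (lt_irrefl _)) 0
    rw [cfc_const_zero] at h3
    simp only [zero_apply, norm_zero, add_zero] at h3
    exact h3.not_gt hlt1
  · intro hnull
    by_contra! hlt
    obtain ⟨d, -, h1, h2⟩ := ENNReal.lt_iff_exists_real_btwn.1 hlt
    obtain ⟨α, β, M, hw, hM, hlt1⟩ := hw d (hBd h1)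
    set R := resolventOp H (-1)
    set F := spectrum ℝ R ∩ {s | |1 - (1 + lam) * s| ≤ d * s} with hFdef
    have hFess : ∀ s ∈ F, s ≠ 0 ∧ ¬ AccPt s (𝓟 (spectrum ℝ R)) ∧
        FiniteDimensional ℂ (eigenspace H ((s⁻¹ - 1 : ℝ) : ℂ)) := by
      rintro s ⟨hs, hsd⟩
      obtain ⟨h0, h4⟩ := hnear hs hsd
      have hspec := hR.inv_sub_one_mem_spec hs h0
      have hess : ((s⁻¹ - 1 : ℝ) : ℂ) ∉ essSpec H := fun h =>
        lt_irrefl _ (h2.trans_le ((Metric.infEDist_le_edist_of_mem h).trans h4))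
      have hacc : ¬ AccPt ((s⁻¹ - 1 : ℝ) : ℂ) (𝓟 (spec H)) := fun h => hess (Or.inl ⟨hspec, h⟩)
      refine ⟨h0, hR.not_accPt_spectrum h0 hacc, ?_⟩
      by_contra hfin
      exact hess (Or.inr ⟨hspec, hacc, hfin⟩)
    have hFcompact : IsCompact F :=
      (spectrum.isCompact (𝕜 := ℝ) R).inter_right
        (isClosed_le (f := fun s : ℝ => |1 - (1 + lam) * s|) (g := fun s => d * s)
          (by fun_prop) (by fun_prop))
    -- An infinite subset of the compact set `F` would accumulate in `F`, but no point of `F` is an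
    -- accumulation point of the spectrum.
    have hFfin : F.Finite := by
      by_contra hinf
      obtain ⟨s, hs, hacc⟩ := Set.Infinite.exists_accPt_of_subset_isCompact hinf hFcompact le_rfl
      exact (hFess s hs).2.1 (hacc.mono (principal_mono.2 inter_subset_left))
    classical
    let e : ℝ → ℝ → ℝ := fun i s => if s = i then M else 0
    have he : ∀ i ∈ hFfin.toFinset, ContinuousOn (e i) (spectrum ℝ R) := fun i hi =>
      continuousOn_ite_eq (hFess i (hFfin.mem_toFinset.1 hi)).2.1
    have hsum : ∀ s, (∑ i ∈ hFfin.toFinset, e i) s = if s ∈ F then M else 0 := by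
      intro s
      simp [e, Finset.sum_apply]
    have h3 := hbound hw (χ := ∑ i ∈ hFfin.toFinset, e i)
      (by rw [show (∑ i ∈ hFfin.toFinset, e i) = fun s => ∑ i ∈ hFfin.toFinset, e i s from
            funext fun s => Finset.sum_apply _ _ _]
          exact continuousOn_finsetSum _ he)
      (fun s => by rw [hsum]; split_ifs <;> [exact hM; exact le_rfl])
      (fun s hs hsd => by rw [hsum, if_pos ⟨hs, hsd⟩])
    have h4 : Tendsto (fun j => cfc (∑ i ∈ hFfin.toFinset, e i) R (ψ j : E)) atTop (𝓝 0) := by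
      rw [cfc_sum e R _ he]
      simp only [sum_apply]
      rw [show (0 : E) = ∑ i ∈ hFfin.toFinset, (0 : E) by simp]
      refine tendsto_finsetSum _ fun i hi => ?_
      obtain ⟨h0, hacc, hfin⟩ := hFess i (hFfin.mem_toFinset.1 hi)
      exact tendsto_zero_of_finiteDimensional_range (hR.cfc_ite_eq_apply_mem hH h0 hacc) hnull
    have h5 := h4.norm.const_add ((α + β) * δ)
    rw [norm_zero, add_zero] at h5
    exact (ge_of_tendsto' h5 h3).not_gt hlt1

end Converse

end GenWeyl

theorem theorem2p2 {E : Type*} [NormedAddCommGroup E] [InnerProductSpace ℂ E] [CompleteSpace E]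
    (H : E →ₗ.[ℂ] E) (hH : IsSelfAdjoint H) (hpos : GenWeyl.IsNonneg H)
    (f g : ℝ → ℝ)
    (hf : ContinuousOn f (Ici 0)) (hf_pos : ∀ t, 0 ≤ t → 0 < f t) (hf_bdd : BddAbove (f '' Ici 0))
    (hg : ContinuousOn g (Ici 0)) (hg_pos : ∀ t, 0 ≤ t → 0 < g t) (hg_bdd : BddAbove (g '' Ici 0))
    (hg_low : ∀ a : ℝ, 0 ≤ a → ∃ c : ℝ, 0 < c ∧ ∀ t, a + 1 ≤ t → c ≤ g t * (t - a))
    (lam : ℝ) (hlam : 0 ≤ lam) (δ : ℝ) (hδ : 0 < δ) (hδc : δ < GenWeyl.c₀ f g) :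
    -- existence of approximate eigenvectors
    (Metric.infEDist (lam : ℂ) (GenWeyl.spec H) < ENNReal.ofReal (δ / GenWeyl.c₀ f g) →
      ∃ ψ : ℕ → H.domain, GenWeyl.IsApproxSeq H f g lam δ ψ) ∧
    (Metric.infEDist (lam : ℂ) (GenWeyl.essSpec H) < ENNReal.ofReal (δ / GenWeyl.c₀ f g) →
      ∃ ψ : ℕ → H.domain, GenWeyl.IsApproxSeq H f g lam δ ψ ∧ GenWeyl.WeaklyNull H ψ) ∧
    -- the converse for `lam > 0`, for `δ` so small that the bound is at most `1`
    (∀ B : ℝ, B = ((GenWeyl.c₁ f lam + GenWeyl.c₂ g lam + GenWeyl.c₃ g lam) /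
          (GenWeyl.c₁ f lam * GenWeyl.c₂ g lam)) ^ (1 / 3 : ℝ) * δ ^ (1 / 3 : ℝ) →
      0 < lam → B ≤ 1 → ∀ ψ : ℕ → H.domain, GenWeyl.IsApproxSeq H f g lam δ ψ →
        Metric.infEDist (lam : ℂ) (GenWeyl.spec H) ≤ ENNReal.ofReal B ∧
        (GenWeyl.WeaklyNull H ψ →
          Metric.infEDist (lam : ℂ) (GenWeyl.essSpec H) ≤ ENNReal.ofReal B)) ∧
    -- the converse for `lam = 0`, for `δ` so small that the bound is less than `1`
    (∀ B : ℝ, B = δ / GenWeyl.c₂ g lam →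
      lam = 0 → B < 1 → ∀ ψ : ℕ → H.domain, GenWeyl.IsApproxSeq H f g lam δ ψ →
        Metric.infEDist (lam : ℂ) (GenWeyl.spec H) ≤ ENNReal.ofReal B ∧
        (GenWeyl.WeaklyNull H ψ →
          Metric.infEDist (lam : ℂ) (GenWeyl.essSpec H) ≤ ENNReal.ofReal B)) := by
  have hfC := GenWeyl.abs_le_c₀_left (g := g) hf_pos hf_bdd
  have hgC := GenWeyl.abs_le_c₀_right (f := f) hg_pos hg_bdd
  have hR := GenWeyl.isResolventAt_resolventOp hH hpos
  have hδ0 : 0 ≤ δ / GenWeyl.c₀ f g := (div_pos hδ (hδ.trans hδc)).le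
  have hdist : ∀ {z : ℂ}, edist (lam : ℂ) z < ENNReal.ofReal (δ / GenWeyl.c₀ f g) →
      dist z lam < δ / GenWeyl.c₀ f g := fun h => by
    rw [edist_comm, edist_dist] at h
    exact (ENNReal.ofReal_lt_ofReal_iff_of_nonneg dist_nonneg).1 h
  have hc₁ := GenWeyl.c₁_pos hf hf_pos hlam
  have hc₂ := GenWeyl.c₂_pos hg hg_pos hlam (hg_low lam hlam)
  have hc₃ := GenWeyl.c₃_nonneg hg_pos hg_bdd hlam
  refine ⟨fun h => ?_, fun h => ?_, fun B hB hlam0 hB1 ψ hψ => ?_, fun B hB hlam0 hB1 ψ hψ => ?_⟩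
  · obtain ⟨z, hz, hzd⟩ := Metric.infEDist_lt_iff.1 h
    obtain ⟨ψ, h1, h2⟩ := hR.exists_seq_of_mem_spec hH hpos hz (hdist hzd)
    exact ⟨fun _ => ψ, GenWeyl.isApproxSeq_of_norm_shift_le hH hpos hf hfC hg hgC hδ hδc
      (fun _ => h1) fun _ => h2⟩
  · obtain ⟨z, hz, hzd⟩ := Metric.infEDist_lt_iff.1 h
    obtain ⟨ψ, h1, h2⟩ := hR.exists_orthonormal_of_mem_essSpec hH hpos hz (hdist hzd)
    exact ⟨ψ, GenWeyl.isApproxSeq_of_norm_shift_le hH hpos hf hfC hg hgC hδ hδc h1.1 h2,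
      h1.tendsto_inner_zero⟩
  · refine GenWeyl.infEDist_le_of_isTestWeight hH hpos hf hf_pos hfC hg hgC hlam
      (fun d hd => ?_) hψ
    have hd0 : 0 < d := lt_of_le_of_lt (by rw [hB]; positivity) hd
    have hε : 0 < min d 1 := lt_min hd0 one_pos
    exact ⟨_, _, _, GenWeyl.isTestWeight_of_pos hf hf_pos hg_pos hg_bdd hlam hc₂ hd0,
      by positivity, GenWeyl.weights_mul_lt_one_of_pos hc₁ hc₂ hc₃ hδ hB hB1 hd⟩
  · refine GenWeyl.infEDist_le_of_isTestWeight hH hpos hf hf_pos hfC hg hgC hlam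
      (fun d hd => ?_) hψ
    have hd0 : 0 < d := lt_of_le_of_lt (by rw [hB]; positivity) hd
    have hε : 0 < min d 1 := lt_min hd0 one_pos
    refine ⟨_, _, _, GenWeyl.isTestWeight_of_eq_zero hg_pos hg_bdd hlam0 hc₂ hd0,
      by positivity, ?_⟩
    -- Only `β` remains, and `β δ < 1` means `B < min d 1`; this is why `B < 1` must be strict here.
    have hBε : B < min d 1 := lt_min hd hB1
    rw [hB, div_lt_iff₀ hc₂] at hBε
    rw [zero_add, one_div_mul_eq_div, div_lt_one (by positivity)]
    linarith
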